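/- Let $2^{<\omega}$ and $2^\omega$ denote the sets of finite and of infinite binary sequences. For $\sigma\in 2^{<\omega}$ let $[\![\sigma]\!]\subseteq 2^\omega$ be the set of infinite extensions of $\sigma$. For $p\in[0,1]$ let $\mu_p$ be the Bernoulli $p$-measure on $2^\omega$: the probability measure with $\mu_p(\sigma):=\mu_p([\![\sigma]\!])=p^{\#_0(\sigma)}(1-p)^{\#_1(\sigma)}$, where $\#_i(\sigma)$ is the number of occurrences of the symbol $i$ in $\sigma$. As an oracle, $p$ is identified with its binary expansion. A sequence $x\in2^\omega$ is *Bernoulli $p$-random* if $x\notin\bigcap_i U_i$ for every sequence $(U_i)_{i\in\omega}$ of uniformly $\Sigma^{0,p}_1$ subsets of $2^\omega$ (effectively open relative to $p$, uniformly in $i$) with $\mu_p(U_i)\le 2^{-i}$ for all $i$. A *semimeasure* is a function $\rho:2^{<\omega}\to[0,1]$ with $\rho(\emptyset)\le 1$ and $\rho(\sigma)\ge\rho(\sigma0)+\rho(\sigma1)$ for all $\sigma$; it is *left-c.e.* if, uniformly in $\sigma$, $\rho(\sigma)$ is the limit of a computable non-decreasing sequence of rational numbers. A left-c.e. semimeasure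 $M$ is *universal* if for every left-c.e. semimeasure $\rho$ there is a real $c>0$ with $M(\sigma)\ge c\,\rho(\sigma)$ for all $\sigma$. For such $M$, the a priori complexity is $\mathit{KA}(\sigma)=-\log_2 M(\sigma)$; no oracle is involved, and the choice of $M$ affects $\mathit{KA}$ only by a bounded additive term. **Theorem.** Let $p\in[0,1]$ satisfy $p\ge_T\emptyset'$, where $\emptyset'$ is the halting set. Then there is a sequence $y\in2^\omega$ that is not Bernoulli $p$-random such that, for every universal left-c.e. semimeasure $M$ with its a priori complexity $\mathit{KA}$, there is a constant $C$ with $$\mathit{KA}(y{\upharpoonright}n)\ \ge\ -\log_2\mu_p(y{\upharpoonright}n)-C\qquad\text{for all } n\in\omega .$$ -/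

import Mathlib

noncomputable section

namespace BlindBernoulli

/-! ### Strings, sequences and Bernoulli measures

The bit `0` is `false`, the bit `1` is `true`; finite binary strings are `List Bool` and infinite
binary sequences are `ℕ → Bool`. -/

/-- The initial segment of length `n` of `x`. -/
def initSeg (x : ℕ → Bool) (n : ℕ) : List Bool := (List.range n).map x

/-- The basic open set of all infinite sequences that extend the string `σ`. -/
def cylinder (σ : List Bool) : Set (ℕ → Bool) := {x | initSeg x σ.length = σ}

/-- The Bernoulli `p`-measure: the bits are independent, and each is `0` with probability `p` and
`1` with probability `1 - p`. -/
def bernoulliMeas (p : unitInterval) : MeasureTheory.Measure (ℕ → Bool) :=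
  MeasureTheory.Measure.infinitePi fun _ : ℕ => ProbabilityTheory.bernoulliMeasure false true p

/-! ### Oracles -/

/-- A real `p ∈ [0,1]` as an oracle: the `n`-th digit after the binary point of `p`. (For dyadic
`p` this picks one of the expansions; for `p = 1` it is the zero sequence, which is computable,
as is every binary expansion of a rational number.) -/
def binaryDigit (p : unitInterval) (n : ℕ) : ℕ := ⌊(2 : ℝ) ^ (n + 1) * (p : ℝ)⌋₊ % 2

/-- The characteristic function of `∅′`, the halting set: the set of all `e` such that the `e`-th
partial recursive function halts on input `e`. -/
def zeroJump (e : ℕ) : ℕ :=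
  open Classical in
  if ((Denumerable.ofNat Nat.Partrec.Code e).eval e).Dom then 1 else 0

/-- `p` computes the halting set: `p ≥_T ∅′`. -/
def ComputesZeroJump (p : unitInterval) : Prop :=
  TuringReducible (fun e => Part.some (zeroJump e)) (fun n => Part.some (binaryDigit p n))

/-! ### Martin-Löf tests and Bernoulli randomness -/

/-- `U` is a uniformly `Σ⁰₁` sequence of classes relative to the oracle `p`: for some set of pairs
`(i, σ)` that is recursively enumerable in `p` (the domain of a function `f` that is partial
recursive in `p`), `U i` is the union of the basic open sets of the `σ` with `(i, σ)` in that
set. -/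
def UniformlySigma1 (p : unitInterval) (U : ℕ → Set (ℕ → Bool)) : Prop :=
  ∃ f : ℕ × List Bool →. ℕ,
    RecursiveIn {fun n => Part.some (binaryDigit p n)} f ∧
      ∀ i, U i = ⋃ σ ∈ {σ : List Bool | (f (i, σ)).Dom}, cylinder σ

/-- `U` is a `μ_p`-Martin-Löf test relative to `p`. -/
def IsBernoulliTest (p : unitInterval) (U : ℕ → Set (ℕ → Bool)) : Prop :=
  UniformlySigma1 p U ∧ ∀ i : ℕ, bernoulliMeas p (U i) ≤ (2 : ENNReal)⁻¹ ^ i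

/-- `x` is Bernoulli `p`-random: it passes every `μ_p`-Martin-Löf test relative to `p`. -/
def BernoulliRandom (p : unitInterval) (x : ℕ → Bool) : Prop :=
  ∀ U : ℕ → Set (ℕ → Bool), IsBernoulliTest p U → x ∉ ⋂ i, U i

/-! ### A priori complexity -/

/-- Semimeasures `ρ : 2^{<ω} → [0,1]`. -/
structure IsSemimeasure (ρ : List Bool → ℝ) : Prop where
  mem_Icc : ∀ σ, ρ σ ∈ Set.Icc (0 : ℝ) 1
  nil_le_one : ρ [] ≤ 1
  add_le : ∀ σ, ρ (σ ++ [false]) + ρ (σ ++ [true]) ≤ ρ σ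

/-- `ρ` is left-c.e.: uniformly in `σ`, the value `ρ σ` is the limit of a computable,
non-decreasing sequence of (non-negative) rational numbers `num σ s / (den σ s + 1)`. Restricting
to non-negative rationals is harmless for `ρ ≥ 0`, as negative terms can be replaced by `0`. -/
def IsLeftCE (ρ : List Bool → ℝ) : Prop :=
  ∃ num den : List Bool → ℕ → ℕ, Computable₂ num ∧ Computable₂ den ∧
    ∀ σ, Monotone (fun s => (num σ s : ℝ) / ((den σ s : ℝ) + 1)) ∧
      Filter.Tendsto (fun s => (num σ s : ℝ) / ((den σ s : ℝ) + 1)) Filter.atTop (nhds (ρ σ))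

/-- `M` is a universal left-c.e. semimeasure: it is a left-c.e. semimeasure and dominates every
left-c.e. semimeasure up to a positive multiplicative constant. -/
structure IsUniversalSemimeasure (M : List Bool → ℝ) : Prop where
  isSemimeasure : IsSemimeasure M
  isLeftCE : IsLeftCE M
  dominates : ∀ ρ : List Bool → ℝ, IsSemimeasure ρ → IsLeftCE ρ →
    ∃ c : ℝ, 0 < c ∧ ∀ σ, c * ρ σ ≤ M σ

/-- The a priori complexity `KA(σ) = -log M(σ)` given by a universal left-c.e. semimeasure `M`
(which is everywhere positive); logarithms are binary. -/
def KA (M : List Bool → ℝ) (σ : List Bool) : ℝ := -Real.logb 2 (M σ)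

end BlindBernoulli

end

/-!
Let `M` be a left-c.e. semimeasure. The halting set, and hence `p`, computes approximations to `M`
of any prescribed precision, so `p` computes a sequence `y` which extends `σ` by a bit `b` with
`M (σb) ≤ μ_p(b) * (M σ + error)`. Up to rounding such a bit exists, since
`M (σ0) + M (σ1) ≤ M σ = μ_p(0) * M σ + μ_p(1) * M σ`. As `0 < p < 1` (otherwise the digits of `p`
would be computable), `μ_p` decreases at most exponentially along `y`; with errors that decay
faster, the increments of `M (y↾n) / μ_p(y↾n)` are summable and this ratio stays bounded. On the
other hand `μ_p` decreases at least exponentially along `y`, so the cylinders of `y`, which are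
uniformly computable from `p`, contain a test that `y` fails.
-/

namespace BlindBernoulli

open MeasureTheory ProbabilityTheory

section Computability

variable {α β γ δ : Type*} [Primcodable α] [Primcodable β] [Primcodable γ] [Primcodable δ]
  {O : Set (ℕ →. ℕ)}

theorem computableIn_comp {f : β → γ} {g : α → β} (hf : ComputableIn O f)
    (hg : ComputableIn O g) : ComputableIn O fun a => f (g a) := by
  refine (Nat.RecursiveIn.comp hf hg).of_eq fun n => ?_
  cases (Encodable.decode n : Option α) <;> simp

theorem computableIn_pair {f : α → β} {g : α → γ} (hf : ComputableIn O f)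
    (hg : ComputableIn O g) : ComputableIn O fun a => (f a, g a) := by
  refine (Nat.RecursiveIn.pair hf hg).of_eq fun n => ?_
  cases (Encodable.decode n : Option α) <;> simp [Seq.seq]

theorem computableIn₂_comp {f : β → γ → δ} {g : α → β} {h : α → γ} (hf : ComputableIn₂ O f)
    (hg : ComputableIn O g) (hh : ComputableIn O h) : ComputableIn O fun a => f (g a) (h a) :=
  computableIn_comp (f := fun x : β × γ => f x.1 x.2) hf (computableIn_pair hg hh)

theorem computableIn_of_succ_eq {f : ℕ → α → α} {g : ℕ → α} (hf : ComputableIn₂ O f)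
    (hg : ∀ n, g (n + 1) = f n (g n)) : ComputableIn O g := by
  have hstart : Nat.RecursiveIn O fun _ => Part.some (Encodable.encode (g 0)) :=
    RecursiveIn.iff_nat.1 (ComputableIn.const (α := ℕ) _)
  have hstep := Nat.RecursiveIn.prec hstart (Nat.RecursiveIn.comp hf Nat.RecursiveIn.right)
  have hpair : Nat.RecursiveIn O fun n => Part.some (Nat.pair 0 n) :=
    (Primrec₂.natPair.comp (Primrec.const 0) Primrec.id).computableIn.recursiveIn |>
      RecursiveIn.iff_nat.1
  refine (Nat.RecursiveIn.comp hstep hpair).of_eq fun n => ?_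
  simp only [Part.bind_eq_bind, Part.bind_some, Nat.unpair_pair, Encodable.decode_nat,
    Part.coe_some, Part.map_some]
  induction n with
  | zero => rfl
  | succ n ih =>
    dsimp only
    rw [ih]
    simp [hg]

theorem recursiveIn_rfind {f : α → ℕ → Bool} (hf : ComputableIn₂ O f) :
    RecursiveIn O fun a => Nat.rfind fun m => Part.some (f a m) := by
  have hf' : ComputableIn O fun x : α × ℕ => (!f x.1 x.2).toNat :=
    computableIn_comp (f := fun b : Bool => (!b).toNat) (Primrec.dom_finite _).computableIn hf
  refine (Nat.RecursiveIn.rfind hf').of_eq fun n => ?_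
  cases hn : (Encodable.decode n : Option α) with
  | none =>
    simp only [Part.coe_none, Part.bind_none]
    refine Part.eq_none_iff.2 fun a ha => ?_
    have := Nat.rfind_spec ha
    simp [hn] at this
  | some a => simp [hn, Part.map_id']

theorem computableIn_of_eq_true_iff_le {f : α → ℕ → Bool} {g : α → ℕ} (hf : ComputableIn₂ O f)
    (hfg : ∀ a m, f a m = true ↔ g a ≤ m) : ComputableIn O g := by
  refine (recursiveIn_rfind hf).of_eq_tot fun a => Nat.mem_rfind.2 ⟨?_, fun {m} hm => ?_⟩
  · simp [(hfg a _).2 le_rfl]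
  · simp [Bool.eq_false_iff.2 (mt (hfg a m).1 hm.not_ge)]

theorem exists_recursiveIn_dom_iff {f : α → Bool} (hf : ComputableIn O f) :
    ∃ φ : α →. ℕ, RecursiveIn O φ ∧ ∀ a, (φ a).Dom ↔ f a = true := by
  refine ⟨_, recursiveIn_rfind (f := fun a _ => f a) (computableIn_comp hf ComputableIn.fst),
    fun a => Nat.rfind_dom.trans (by simp)⟩

theorem exists_computable_zeroJump_eq_one_iff {P : α → Prop} (hP : REPred P) :
    ∃ e : α → ℕ, Computable e ∧ ∀ a, zeroJump (e a) = 1 ↔ P a := by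
  obtain ⟨c, hc⟩ := Nat.Partrec.Code.exists_code.1 (Nat.Partrec.comp hP Nat.Partrec.left)
  refine ⟨fun a => Encodable.encode (Nat.Partrec.Code.curry c (Encodable.encode a)),
    Computable.encode.comp (Nat.Partrec.Code.primrec₂_curry.to_comp.comp (Computable.const c)
      Computable.encode), fun a => ?_⟩
  simp [zeroJump, Nat.Partrec.Code.eval_curry, hc, Part.assert]

theorem computableIn_decide_of_rePred (hO : ComputableIn O zeroJump) {P : α → Prop}
    [DecidablePred P] (hP : REPred P) : ComputableIn O fun a => decide (P a) := by
  obtain ⟨e, he, heP⟩ := exists_computable_zeroJump_eq_one_iff hP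
  have hone : Primrec fun n : ℕ => decide (n = 1) :=
    Primrec.eq.decide.comp Primrec.id (Primrec.const 1)
  simpa only [heP] using
    computableIn_comp hone.computableIn (computableIn_comp hO he.computableIn)

end Computability

section Oracle

variable {p : unitInterval}

/-- The oracle given by the binary digits of `p`. -/
abbrev digitOracle (p : unitInterval) : Set (ℕ →. ℕ) := {fun n => Part.some (binaryDigit p n)}

theorem computableIn_binaryDigit (p : unitInterval) :
    ComputableIn (digitOracle p) (binaryDigit p) :=
  RecursiveIn.oracle _ rfl

theorem not_computable_binaryDigit (hp : ComputesZeroJump p) : ¬ Computable (binaryDigit p) := by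
  classical
  intro hdigit
  have hhalt := computableIn_decide_of_rePred hp (ComputablePred.halting_problem_re 0)
  refine ComputablePred.halting_problem 0 ⟨inferInstance, hhalt.partrec_of_oracle ?_⟩
  rintro _ rfl
  exact hdigit

theorem pos_of_computesZeroJump (hp : ComputesZeroJump p) : 0 < (p : ℝ) := by
  refine lt_of_le_of_ne p.2.1 fun h => not_computable_binaryDigit hp ?_
  have : binaryDigit p = fun _ => 0 := by funext n; simp [binaryDigit, ← h]
  exact this ▸ Computable.const 0

theorem lt_one_of_computesZeroJump (hp : ComputesZeroJump p) : (p : ℝ) < 1 := by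
  refine lt_of_le_of_ne p.2.2 fun h => not_computable_binaryDigit hp ?_
  have hfloor (n : ℕ) : ⌊(2 : ℝ) ^ n⌋₊ = 2 ^ n := by
    exact_mod_cast Nat.floor_natCast (R := ℝ) (2 ^ n)
  have : binaryDigit p = fun _ => 0 := by
    funext n
    rw [binaryDigit, h, mul_one, hfloor, pow_succ, Nat.mul_mod_left]
  exact this ▸ Computable.const 0

theorem floor_two_pow_succ_mul_div_two (x : ℝ) (n : ℕ) :
    ⌊2 ^ (n + 1) * x⌋₊ / 2 = ⌊2 ^ n * x⌋₊ := by
  rw [← Nat.floor_div_ofNat]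
  congr 1
  ring

theorem computableIn_floor_two_pow_mul (p : unitInterval) :
    ComputableIn (digitOracle p) fun k : ℕ => ⌊(2 : ℝ) ^ k * (p : ℝ)⌋₊ := by
  have hdouble : ComputableIn₂ (digitOracle p) fun m b : ℕ => 2 * m + b :=
    (Primrec.nat_add.comp (Primrec.nat_mul.comp (Primrec.const 2) Primrec.fst)
      Primrec.snd).computableIn
  refine computableIn_of_succ_eq (f := fun n m => 2 * m + binaryDigit p n)
    (computableIn₂_comp (f := fun m b => 2 * m + b) hdouble ComputableIn.snd
      (computableIn_comp (computableIn_binaryDigit p) ComputableIn.fst)) fun n => ?_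
  rw [← floor_two_pow_succ_mul_div_two (p : ℝ) n, binaryDigit]
  exact (Nat.div_add_mod _ 2).symm

end Oracle

section Measure

variable {p : unitInterval}

theorem length_initSeg (x : ℕ → Bool) (n : ℕ) : (initSeg x n).length = n := by simp [initSeg]

theorem initSeg_succ (x : ℕ → Bool) (n : ℕ) : initSeg x (n + 1) = initSeg x n ++ [x n] := by
  simp [initSeg, List.range_succ]

theorem mem_cylinder_initSeg {x y : ℕ → Bool} {n : ℕ} :
    x ∈ cylinder (initSeg y n) ↔ ∀ i < n, x i = y i := by
  simp [cylinder, initSeg]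

/-- The probability of the bit `b` under the Bernoulli `p`-measure. -/
noncomputable def bitProb (p : unitInterval) : Bool → ℝ
  | false => p
  | true => 1 - p

theorem exists_pos_le_bitProb (h0 : 0 < (p : ℝ)) (h1 : (p : ℝ) < 1) :
    ∃ m > 0, ∀ b, m ≤ bitProb p b :=
  ⟨min p (1 - p), lt_min h0 (sub_pos.2 h1), by simp [bitProb]⟩

theorem exists_lt_one_bitProb_le (h0 : 0 < (p : ℝ)) (h1 : (p : ℝ) < 1) :
    ∃ q < 1, ∀ b, bitProb p b ≤ q :=
  ⟨max p (1 - p), max_lt h1 (sub_lt_self 1 h0), by simp [bitProb]⟩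

theorem bitProb_nonneg (p : unitInterval) (b : Bool) : 0 ≤ bitProb p b := by
  cases b
  · exact p.2.1
  · exact sub_nonneg.2 p.2.2

theorem bernoulliMeas_real_cylinder (p : unitInterval) (y : ℕ → Bool) (n : ℕ) :
    (bernoulliMeas p).real (cylinder (initSeg y n)) = ∏ i ∈ Finset.range n, bitProb p (y i) := by
  have h : cylinder (initSeg y n) = Set.pi (Finset.range n) fun i => {y i} := by
    ext x; simp [mem_cylinder_initSeg]
  rw [h, bernoulliMeas, measureReal_def, Measure.infinitePi_pi _
    (fun _ _ => MeasurableSet.singleton _), ENNReal.toReal_prod]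
  refine Finset.prod_congr rfl fun i _ => ?_
  rw [← measureReal_def, bernoulliMeasure_real_apply _ (MeasurableSet.singleton _)]
  cases y i <;> simp [bitProb]

theorem bernoulliMeas_real_cylinder_succ (p : unitInterval) (y : ℕ → Bool) (n : ℕ) :
    (bernoulliMeas p).real (cylinder (initSeg y (n + 1))) =
      (bernoulliMeas p).real (cylinder (initSeg y n)) * bitProb p (y n) := by
  simp only [bernoulliMeas_real_cylinder, Finset.prod_range_succ]

theorem bernoulliMeas_real_cylinder_le_pow {q : ℝ} (hq : ∀ b, bitProb p b ≤ q) (y : ℕ → Bool)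
    (n : ℕ) : (bernoulliMeas p).real (cylinder (initSeg y n)) ≤ q ^ n := by
  rw [bernoulliMeas_real_cylinder]
  simpa using Finset.prod_le_prod (s := Finset.range n) (fun i _ => bitProb_nonneg p (y i))
    fun i _ => hq (y i)

theorem pow_le_bernoulliMeas_real_cylinder {m : ℝ} (hm0 : 0 ≤ m) (hm : ∀ b, m ≤ bitProb p b)
    (y : ℕ → Bool) (n : ℕ) : m ^ n ≤ (bernoulliMeas p).real (cylinder (initSeg y n)) := by
  rw [bernoulliMeas_real_cylinder]
  simpa using Finset.prod_le_prod (s := Finset.range n) (fun _ _ => hm0) fun i _ => hm (y i)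

end Measure

section Randomness

variable {p : unitInterval}

theorem uniformlySigma1_cylinder {g : ℕ → List Bool} (hg : ComputableIn (digitOracle p) g) :
    UniformlySigma1 p fun i => cylinder (g i) := by
  have heq : ComputableIn (digitOracle p) fun x : ℕ × List Bool => decide (x.2 = g x.1) :=
    computableIn₂_comp (f := fun σ τ : List Bool => decide (σ = τ)) Primrec.eq.decide.computableIn₂
      ComputableIn.snd (computableIn_comp hg ComputableIn.fst)
  obtain ⟨φ, hφ, hdom⟩ := exists_recursiveIn_dom_iff heq
  exact ⟨φ, hφ, fun i => by simp [hdom]⟩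

theorem not_bernoulliRandom_of_computableIn (h0 : 0 < (p : ℝ)) (h1 : (p : ℝ) < 1) {y : ℕ → Bool}
    (hy : ComputableIn (digitOracle p) (initSeg y)) : ¬ BernoulliRandom p y := by
  obtain ⟨q, hq1, hq⟩ := exists_lt_one_bitProb_le h0 h1
  have hq0 : 0 ≤ q := (bitProb_nonneg p true).trans (hq true)
  obtain ⟨K, hK⟩ := exists_pow_lt_of_lt_one (show (0 : ℝ) < 2⁻¹ by norm_num) hq1
  have hsigma : UniformlySigma1 p fun i => cylinder (initSeg y (K * i)) :=
    uniformlySigma1_cylinder (computableIn_comp hy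
      (Primrec.nat_mul.comp (Primrec.const K) Primrec.id).computableIn)
  have hmeas (i : ℕ) : bernoulliMeas p (cylinder (initSeg y (K * i))) ≤ (2 : ENNReal)⁻¹ ^ i := by
    have hreal : (bernoulliMeas p).real (cylinder (initSeg y (K * i))) ≤ 2⁻¹ ^ i :=
      calc (bernoulliMeas p).real (cylinder (initSeg y (K * i)))
          ≤ (q ^ K) ^ i := pow_mul q K i ▸ bernoulliMeas_real_cylinder_le_pow hq y (K * i)
        _ ≤ 2⁻¹ ^ i := pow_le_pow_left₀ (pow_nonneg hq0 K) hK.le i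
    have : IsProbabilityMeasure (bernoulliMeas p) := by unfold bernoulliMeas; infer_instance
    refine (ENNReal.toReal_le_toReal (measure_ne_top _ _) (by simp)).1 ?_
    simpa [measureReal_def] using hreal
  exact fun hrandom => hrandom _ ⟨hsigma, hmeas⟩
    (Set.mem_iInter.2 fun _ => mem_cylinder_initSeg.2 fun _ _ => rfl)

end Randomness

section LeftCE

variable {ρ : List Bool → ℝ}

theorem primrec₂_pow : Primrec₂ fun m n : ℕ => m ^ n :=
  Primrec₂.unpaired'.1 Nat.Primrec.pow

theorem IsLeftCE.rePred_lt_two_pow_mul (hρ : IsLeftCE ρ) :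
    REPred fun x : (List Bool × ℕ) × ℕ => (x.2 : ℝ) < 2 ^ x.1.2 * ρ x.1.1 := by
  obtain ⟨num, den, hnum, hden, h⟩ := hρ
  have hσ : Computable fun x : ((List Bool × ℕ) × ℕ) × ℕ => x.1.1.1 :=
    Computable.fst.comp (Computable.fst.comp Computable.fst)
  have hlhs : Computable fun x : ((List Bool × ℕ) × ℕ) × ℕ => x.1.2 * (den x.1.1.1 x.2 + 1) :=
    Primrec.nat_mul.to_comp.comp (Computable.snd.comp Computable.fst)
      (Computable.succ.comp (hden.comp hσ Computable.snd))
  have hrhs : Computable fun x : ((List Bool × ℕ) × ℕ) × ℕ => 2 ^ x.1.1.2 * num x.1.1.1 x.2 :=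
    Primrec.nat_mul.to_comp.comp (primrec₂_pow.to_comp.comp (Computable.const 2)
      (Computable.snd.comp (Computable.fst.comp Computable.fst)))
      (hnum.comp hσ Computable.snd)
  have hlt : Computable₂ fun (x : (List Bool × ℕ) × ℕ) (t : ℕ) =>
      decide (x.2 * (den x.1.1 t + 1) < 2 ^ x.1.2 * num x.1.1 t) :=
    Primrec.nat_lt.decide.to_comp.comp hlhs hrhs
  refine (Partrec.rfind hlt.partrec₂).dom_re.of_eq fun ⟨⟨σ, k⟩, a⟩ => ?_
  obtain ⟨hmono, hlim⟩ := h σ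
  have hcross (t : ℕ) : a * (den σ t + 1) < 2 ^ k * num σ t ↔
      (a : ℝ) < 2 ^ k * ((num σ t : ℝ) / ((den σ t : ℝ) + 1)) := by
    rw [← mul_div_assoc, lt_div_iff₀ (by positivity)]
    exact_mod_cast Iff.rfl
  calc (Nat.rfind _).Dom ↔ ∃ t, a * (den σ t + 1) < 2 ^ k * num σ t :=
        Nat.rfind_dom.trans (by simp)
    _ ↔ ∃ t, (a : ℝ) < 2 ^ k * ((num σ t : ℝ) / ((den σ t : ℝ) + 1)) := exists_congr hcross
    _ ↔ (a : ℝ) < 2 ^ k * ρ σ := by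
      refine ⟨fun ⟨t, ht⟩ => ht.trans_le ?_, fun hlt => ?_⟩
      · gcongr
        exact hmono.ge_of_tendsto hlim t
      · exact ((hlim.const_mul ((2 : ℝ) ^ k)).eventually_const_lt hlt).exists

theorem IsLeftCE.computableIn_ceil {O : Set (ℕ →. ℕ)} (hρ : IsLeftCE ρ)
    (hO : ComputableIn O zeroJump) :
    ComputableIn O fun x : List Bool × ℕ => ⌈2 ^ x.2 * ρ x.1⌉₊ := by
  classical
  have hlt := computableIn_decide_of_rePred hO hρ.rePred_lt_two_pow_mul
  have hge : ComputableIn₂ O fun (x : List Bool × ℕ) (a : ℕ) =>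
      !decide ((a : ℝ) < 2 ^ x.2 * ρ x.1) :=
    computableIn_comp (f := not) Primrec.not.computableIn hlt
  exact computableIn_of_eq_true_iff_le hge fun x a => by simp [Nat.ceil_le]

end LeftCE

section Greedy

variable {p : unitInterval} {ρ : List Bool → ℝ}

/-- The bit by which the greedy sequence extends `σ`: it is `0` if, computed with precision
`2 ^ (-k)`, the value of `ρ` at `σ0` is at most `p * ρ σ`. All quantities are scaled by `2 ^ k` and
rounded, so that natural numbers computable from `p` are compared. -/
noncomputable def greedyBit (p : unitInterval) (ρ : List Bool → ℝ) (k : ℕ) (σ : List Bool) : Bool :=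
  !decide (⌈2 ^ k * ρ (σ ++ [false])⌉₊ * 2 ^ k ≤ ⌊(2 : ℝ) ^ k * (p : ℝ)⌋₊ * ⌈2 ^ k * ρ σ⌉₊)

theorem computableIn_greedyBit (hp : ComputesZeroJump p) (hρ : IsLeftCE ρ) :
    ComputableIn₂ (digitOracle p) (greedyBit p ρ) := by
  have hceil : ComputableIn₂ (digitOracle p) fun (τ : List Bool) (k : ℕ) => ⌈2 ^ k * ρ τ⌉₊ :=
    hρ.computableIn_ceil hp
  have hmul : ComputableIn₂ (digitOracle p) fun m n : ℕ => m * n := Primrec.nat_mul.computableIn₂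
  have hgt : ComputableIn₂ (digitOracle p) fun m n : ℕ => !decide (m ≤ n) :=
    (Primrec.not.comp Primrec.nat_le.decide).computableIn
  have happend : ComputableIn (digitOracle p) fun x : ℕ × List Bool => x.2 ++ [false] :=
    (Primrec.list_append.comp Primrec.snd (Primrec.const [false])).computableIn
  have hpow : ComputableIn (digitOracle p) fun x : ℕ × List Bool => 2 ^ x.1 :=
    (primrec₂_pow.comp (Primrec.const 2) Primrec.fst).computableIn
  have hfloor : ComputableIn (digitOracle p) fun x : ℕ × List Bool => ⌊(2 : ℝ) ^ x.1 * (p : ℝ)⌋₊ :=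
    computableIn_comp (f := fun k : ℕ => ⌊(2 : ℝ) ^ k * (p : ℝ)⌋₊)
      (computableIn_floor_two_pow_mul p) ComputableIn.fst
  have hchild := computableIn₂_comp hceil happend ComputableIn.fst
  have hparent := computableIn₂_comp hceil (ComputableIn.snd (α := ℕ)) ComputableIn.fst
  exact computableIn₂_comp (f := fun m n => !decide (m ≤ n)) hgt
    (computableIn₂_comp hmul hchild hpow) (computableIn₂_comp hmul hfloor hparent)

theorem greedyBit_eq_false_iff {k : ℕ} {σ : List Bool} :
    greedyBit p ρ k σ = false ↔ (⌈2 ^ k * ρ (σ ++ [false])⌉₊ / 2 ^ k : ℝ) ≤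
      ⌊(2 : ℝ) ^ k * (p : ℝ)⌋₊ / 2 ^ k * (⌈2 ^ k * ρ σ⌉₊ / 2 ^ k) := by
  rw [greedyBit, Bool.not_eq_false', decide_eq_true_eq, div_mul_div_comm,
    div_le_div_iff₀ (by positivity) (by positivity), ← mul_assoc,
    mul_le_mul_iff_left₀ (by positivity)]
  exact_mod_cast Iff.rfl

theorem ceil_mul_div_mem_Icc {T x : ℝ} (hT : 0 < T) (hx : 0 ≤ x) :
    (⌈T * x⌉₊ / T : ℝ) ∈ Set.Icc x (x + T⁻¹) := by
  rw [Set.mem_Icc, le_div_iff₀' hT, div_le_iff₀' hT, mul_add, mul_inv_cancel₀ hT.ne']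
  exact ⟨Nat.le_ceil _, (Nat.ceil_lt_add_one (by positivity)).le⟩

theorem floor_mul_div_mem_Icc {T x : ℝ} (hT : 0 < T) (hx : 0 ≤ x) :
    (⌊T * x⌋₊ / T : ℝ) ∈ Set.Icc (x - T⁻¹) x := by
  rw [Set.mem_Icc, le_div_iff₀' hT, div_le_iff₀' hT, mul_sub, mul_inv_cancel₀ hT.ne']
  exact ⟨(Nat.sub_one_lt_floor _).le, Nat.floor_le (by positivity)⟩

theorem apply_append_greedyBit_le (h1 : (p : ℝ) < 1) (hρ : IsSemimeasure ρ) (k : ℕ)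
    (σ : List Bool) :
    ρ (σ ++ [greedyBit p ρ k σ]) ≤
      bitProb p (greedyBit p ρ k σ) * (ρ σ + 2 / (1 - p) * (2⁻¹ : ℝ) ^ k) := by
  have hT : (0 : ℝ) < 2 ^ k := by positivity
  have hgreedy := greedyBit_eq_false_iff (p := p) (ρ := ρ) (k := k) (σ := σ)
  obtain ⟨hx, hx'⟩ := ceil_mul_div_mem_Icc hT (hρ.mem_Icc σ).1
  obtain ⟨hx₀, hx₀'⟩ := ceil_mul_div_mem_Icc hT (hρ.mem_Icc (σ ++ [false])).1
  obtain ⟨hq, hq'⟩ := floor_mul_div_mem_Icc hT p.2.1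
  set a : ℝ := ⌈2 ^ k * ρ σ⌉₊ / 2 ^ k
  set a₀ : ℝ := ⌈2 ^ k * ρ (σ ++ [false])⌉₊ / 2 ^ k
  set q : ℝ := ⌊(2 : ℝ) ^ k * (p : ℝ)⌋₊ / 2 ^ k
  rw [inv_pow]
  set ε : ℝ := (2 ^ k)⁻¹
  have hp1 : 0 < 1 - (p : ℝ) := sub_pos.2 h1
  have hp0 : 0 ≤ (p : ℝ) := p.2.1
  have hε : 0 < ε := inv_pos.2 hT
  have ha : 0 ≤ a := (hρ.mem_Icc σ).1.trans hx
  have hq0 : 0 ≤ q := by positivity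
  cases hbit : greedyBit p ρ k σ with
  | false =>
    have hD : 1 ≤ 2 / (1 - (p : ℝ)) := by rw [le_div_iff₀ hp1]; linarith
    calc ρ (σ ++ [false]) ≤ q * a := hx₀.trans (hgreedy.1 hbit)
      _ ≤ p * (ρ σ + ε) := mul_le_mul hq' hx' ha hp0
      _ ≤ p * (ρ σ + 2 / (1 - p) * ε) := by gcongr; exact le_mul_of_one_le_left hε.le hD
  | true =>
    have hlt : q * a < a₀ := not_le.1 fun h => by simp [hgreedy.2 h] at hbit
    have hε' : ε * ρ σ ≤ ε := mul_le_of_le_one_right hε.le (hρ.mem_Icc σ).2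
    have hqa : p * ρ σ - ε ≤ q * a :=
      calc p * ρ σ - ε ≤ (p - ε) * ρ σ := by rw [sub_mul]; linarith
        _ ≤ q * a := mul_le_mul hq hx (hρ.mem_Icc σ).1 hq0
    calc ρ (σ ++ [true]) ≤ ρ σ - ρ (σ ++ [false]) := le_sub_iff_add_le'.2 (hρ.add_le σ)
      _ ≤ (1 - p) * ρ σ + 2 * ε := by linarith
      _ = (1 - p) * (ρ σ + 2 / (1 - p) * ε) := by field_simp

theorem exists_forall_eq_apply_initSeg (F : List Bool → Bool) :
    ∃ y : ℕ → Bool, ∀ n, y n = F (initSeg y n) := by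
  let s : ℕ → List Bool := Nat.rec [] fun _ σ => σ ++ [F σ]
  have hs (n : ℕ) : initSeg (fun i => F (s i)) n = s n := by
    induction n with
    | zero => rfl
    | succ n ih => rw [initSeg_succ, ih]
  exact ⟨fun i => F (s i), fun n => by rw [hs]⟩

theorem computableIn_initSeg {O : Set (ℕ →. ℕ)} {F : List Bool → Bool} (hF : ComputableIn O F)
    {y : ℕ → Bool} (hy : ∀ n, y n = F (initSeg y n)) : ComputableIn O (initSeg y) := by
  have hsnoc : ComputableIn₂ O fun (σ : List Bool) (b : Bool) => σ ++ [b] :=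
    (Primrec.list_append.comp Primrec.fst
      (Primrec.list_cons.comp Primrec.snd (Primrec.const []))).computableIn
  exact computableIn_of_succ_eq (f := fun _ σ => σ ++ [F σ])
    (computableIn₂_comp (f := fun σ b => σ ++ [b]) hsnoc ComputableIn.snd
      (computableIn_comp hF ComputableIn.snd))
    fun n => by rw [initSeg_succ, ← hy]

theorem exists_computableIn_apply_initSeg_succ_le (hp : ComputesZeroJump p) (hs : IsSemimeasure ρ)
    (hc : IsLeftCE ρ) (L : ℕ) :
    ∃ y : ℕ → Bool, ComputableIn (digitOracle p) (initSeg y) ∧ ∀ n, ρ (initSeg y (n + 1)) ≤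
      bitProb p (y n) * (ρ (initSeg y n) + 2 / (1 - p) * (2⁻¹ : ℝ) ^ (L * n)) := by
  obtain ⟨y, hy⟩ := exists_forall_eq_apply_initSeg fun σ => greedyBit p ρ (L * σ.length) σ
  have hprec : ComputableIn (digitOracle p) fun σ : List Bool => L * σ.length :=
    (Primrec.nat_mul.comp (Primrec.const L) Primrec.list_length).computableIn
  refine ⟨y, computableIn_initSeg
    (computableIn₂_comp (computableIn_greedyBit hp hc) hprec ComputableIn.id) hy, fun n => ?_⟩
  have hstep := apply_append_greedyBit_le (lt_one_of_computesZeroJump hp) hs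
    (L * (initSeg y n).length) (initSeg y n)
  rwa [← hy, ← initSeg_succ, length_initSeg] at hstep

theorem le_mul_bernoulliMeas_real_cylinder {m ε D : ℝ} {y : ℕ → Bool} {f : ℕ → ℝ} (hm0 : 0 < m)
    (hm : ∀ b, m ≤ bitProb p b) (hD : 0 ≤ D) (hε0 : 0 ≤ ε) (hε : ε ≤ m / 2) (hf0 : f 0 ≤ 1)
    (hf : ∀ n, f (n + 1) ≤ bitProb p (y n) * (f n + D * ε ^ n)) (n : ℕ) :
    f n ≤ (1 + D * 2) * (bernoulliMeas p).real (cylinder (initSeg y n)) := by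
  set μ : ℕ → ℝ := fun n => (bernoulliMeas p).real (cylinder (initSeg y n)) with hμ
  have hmμ (n : ℕ) : m ^ n ≤ μ n := pow_le_bernoulliMeas_real_cylinder hm0.le hm y n
  have hμ0 (n : ℕ) : 0 < μ n := (pow_pos hm0 n).trans_le (hmμ n)
  have herror (n : ℕ) : ε ^ n ≤ (1 / 2) ^ n * μ n :=
    calc ε ^ n ≤ (1 / 2 * m) ^ n := by gcongr; linarith
      _ = (1 / 2) ^ n * m ^ n := mul_pow _ _ _
      _ ≤ (1 / 2) ^ n * μ n := by gcongr; exact hmμ n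
  have hratio (n : ℕ) : f (n + 1) / μ (n + 1) ≤ 1 * (f n / μ n) + D * (1 / 2) ^ n := by
    have hb : 0 < bitProb p (y n) := hm0.trans_le (hm _)
    rw [show μ (n + 1) = bitProb p (y n) * μ n from
        (bernoulliMeas_real_cylinder_succ p y n).trans (mul_comm _ _),
      div_le_iff₀ (mul_pos hb (hμ0 n))]
    calc f (n + 1) ≤ bitProb p (y n) * (f n + D * ((1 / 2) ^ n * μ n)) :=
          (hf n).trans (by gcongr; exact herror n)
      _ = (1 * (f n / μ n) + D * (1 / 2) ^ n) * (bitProb p (y n) * μ n) := by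
          have := (hμ0 n).ne'
          field_simp
  have hμ_zero : μ 0 = 1 := by simp [hμ, bernoulliMeas_real_cylinder]
  have hsum := discrete_gronwall_prod_general (u := fun n => f n / μ n) (n₀ := 0)
    (fun n _ => hratio n) (fun _ _ => zero_le_one) n.zero_le
  rw [← div_le_iff₀ (hμ0 n)]
  simp only [Finset.prod_const_one, mul_one, Nat.Ico_zero_eq_range, ← Finset.mul_sum, hμ_zero,
    div_one] at hsum
  have := mul_le_mul_of_nonneg_left (sum_geometric_two_le n) hD
  linarith

theorem exists_not_bernoulliRandom_le (hp : ComputesZeroJump p) (hs : IsSemimeasure ρ)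
    (hc : IsLeftCE ρ) :
    ∃ y : ℕ → Bool, ¬ BernoulliRandom p y ∧ ∃ C : ℝ, ∀ n,
      ρ (initSeg y n) ≤ C * (bernoulliMeas p).real (cylinder (initSeg y n)) := by
  have h0 := pos_of_computesZeroJump hp
  have h1 := lt_one_of_computesZeroJump hp
  obtain ⟨m, hm0, hm⟩ := exists_pos_le_bitProb h0 h1
  obtain ⟨L, hL⟩ := exists_pow_lt_of_lt_one (half_pos hm0) (show (2⁻¹ : ℝ) < 1 by norm_num)
  obtain ⟨y, hy, hstep⟩ := exists_computableIn_apply_initSeg_succ_le hp hs hc L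
  simp only [pow_mul] at hstep
  exact ⟨y, not_bernoulliRandom_of_computableIn h0 h1 hy, _,
    le_mul_bernoulliMeas_real_cylinder hm0 hm (div_nonneg zero_le_two (sub_pos.2 h1).le)
      (by positivity) hL.le hs.nil_le_one hstep⟩

end Greedy

section Universal

variable {M : List Bool → ℝ}

/-- The uniform measure, as a function on strings. -/
noncomputable def uniformMeas (σ : List Bool) : ℝ := 2⁻¹ ^ σ.length

theorem uniformMeas_pos (σ : List Bool) : 0 < uniformMeas σ := by
  unfold uniformMeas
  positivity

theorem isSemimeasure_uniformMeas : IsSemimeasure uniformMeas where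
  mem_Icc σ := ⟨(uniformMeas_pos σ).le, pow_le_one₀ (by norm_num) (by norm_num)⟩
  nil_le_one := by simp [uniformMeas]
  add_le σ := by
    simp only [uniformMeas, List.length_append, List.length_singleton, pow_succ]
    linarith

theorem isLeftCE_uniformMeas : IsLeftCE uniformMeas := by
  have hden : Computable₂ fun (σ : List Bool) (_ : ℕ) => 2 ^ σ.length - 1 :=
    (Primrec.nat_sub.comp (primrec₂_pow.comp (Primrec.const 2)
      (Primrec.list_length.comp Primrec.fst)) (Primrec.const 1)).to_comp
  refine ⟨fun _ _ => 1, fun σ _ => 2 ^ σ.length - 1, Computable.const 1, hden,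
    fun σ => ⟨monotone_const, ?_⟩⟩
  have : ((1 : ℕ) : ℝ) / (((2 ^ σ.length - 1 : ℕ) : ℝ) + 1) = uniformMeas σ := by
    rw [Nat.cast_sub Nat.one_le_two_pow]
    simp [uniformMeas]
  exact tendsto_const_nhds.congr fun _ => this.symm

theorem IsUniversalSemimeasure.pos (hM : IsUniversalSemimeasure M) (σ : List Bool) : 0 < M σ := by
  obtain ⟨c, hc, h⟩ := hM.dominates _ isSemimeasure_uniformMeas isLeftCE_uniformMeas
  exact (mul_pos hc (uniformMeas_pos σ)).trans_le (h σ)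

-- With this formulation no universal semimeasure has to be constructed: if there is none, any `ρ`
-- will do.
theorem exists_isLeftCE_forall_universal_le :
    ∃ ρ, IsSemimeasure ρ ∧ IsLeftCE ρ ∧
      ∀ M, IsUniversalSemimeasure M → ∃ c : ℝ, 0 < c ∧ ∀ σ, c * M σ ≤ ρ σ := by
  by_cases h : ∃ M, IsUniversalSemimeasure M
  · obtain ⟨M₀, h₀⟩ := h
    exact ⟨M₀, h₀.isSemimeasure, h₀.isLeftCE,
      fun M hM => h₀.dominates M hM.isSemimeasure hM.isLeftCE⟩
  · exact ⟨_, isSemimeasure_uniformMeas, isLeftCE_uniformMeas, fun M hM => (h ⟨M, hM⟩).elim⟩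

theorem IsUniversalSemimeasure.neg_logb_sub_le_KA (hM : IsUniversalSemimeasure M) {C m : ℝ}
    {σ : List Bool} (h : M σ ≤ C * m) :
    -Real.logb 2 m - Real.logb 2 C ≤ KA M σ := by
  have hCm : 0 < C * m := (hM.pos σ).trans_le h
  have hlog := Real.logb_le_logb_of_le one_lt_two (hM.pos σ) h
  rw [Real.logb_mul (left_ne_zero_of_mul hCm.ne') (right_ne_zero_of_mul hCm.ne')] at hlog
  unfold KA
  linarith

end Universal

end BlindBernoulli

theorem theorem5p2 (p : unitInterval) (hp : BlindBernoulli.ComputesZeroJump p) :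
    ∃ y : ℕ → Bool, ¬ BlindBernoulli.BernoulliRandom p y ∧
      ∀ M : List Bool → ℝ, BlindBernoulli.IsUniversalSemimeasure M →
        ∃ C : ℝ, ∀ n : ℕ,
          BlindBernoulli.KA M (BlindBernoulli.initSeg y n) ≥
            -Real.logb 2 ((BlindBernoulli.bernoulliMeas p).real
              (BlindBernoulli.cylinder (BlindBernoulli.initSeg y n))) - C := by
  obtain ⟨ρ, hs, hc, hρ⟩ := BlindBernoulli.exists_isLeftCE_forall_universal_le
  obtain ⟨y, hy, C, hC⟩ := BlindBernoulli.exists_not_bernoulliRandom_le hp hs hc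
  refine ⟨y, hy, fun M hM => ?_⟩
  obtain ⟨c, hc0, hcM⟩ := hρ M hM
  refine ⟨Real.logb 2 (C / c), fun n => ?_⟩
  have hle := (hcM _).trans (hC n)
  rw [← le_div_iff₀' hc0, mul_div_right_comm] at hle
  exact hM.neg_logb_sub_le_KA hle
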